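/- **Setting.** Let $N$ be a finite non-empty set of items with sizes $s(i)>0$, $s(A)=\sum_{i\in A}s(i)$, and let $f:2^N\to\mathbb R_{\ge 0}$ be monotone, submodular and normalized ($f(\emptyset)=0$), with $f(\{j\})>0$ for all $j\in N$. Its curvature is $c=1-\min_{j\in N}\frac{f(N)-f(N\setminus\{j\})}{f(\{j\})}$. For a capacity $\gamma>0$ let $\mathrm{Opt}(\gamma)$ be a set maximizing $f$ among the sets of size at most $\gamma$. A *policy* is a binary decision tree whose nodes are items, no item occurring twice on a path from the root: the item at the current node is packed if it fits into the remaining capacity, and the process continues in the left subtree; otherwise it is discarded, and the process continues in the right subtree. Let $\Pi(\gamma)$ be the set of items packed by the policy $\Pi$ when the capacity is $\gamma$. The *robustness factor* of $\Pi$ is $\inf_\gamma f(\Pi(\gamma))/f(\mathrm{Opt}(\gamma))$, over all $\gamma>0$ with $f(\mathrm{Opt}(\gamma))>0$. The density of $i$ with respect to $S$ is $\frac{f(S\cup\{i\})-f(S)}{s(i)}$; ties are broken by an arbitrary fixed linear order on $N$. **The policy.** *Indispensable items.* For a set $M$ of items and $i^\star\in M$, starting from the empty sequence, repeatedly choose an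 item of $\{i\in M: s(i)\le s(i^\star)\}$ not chosen before that has the largest density with respect to the set $G$ of items chosen before, as long as $s(G)\le s(i^\star)$ and until $i^\star$ is chosen. If $i^\star$ is chosen, $G$ (the items chosen before $i^\star$) is non-empty and $f(G\cup\{i^\star\})-f(G)>f(G)$, then $i^\star$ is *indispensable* in $M$ and $G(M,i^\star)$ denotes $G$ in the order of choice; otherwise $i^\star$ is not indispensable in $M$ and $G(M,i^\star)$ is empty. *Start items.* Start with an empty list $F$ and go through the items $i$ of $N$ in non-decreasing order of size. Put $i$ at the front of $F$ if $i$ is indispensable in $N$, or if $F$ is non-empty and $i$ has the largest density with respect to $\emptyset$ among all items of size at most $s(i)$. *Packing.* Let $M=N$ and $S=\emptyset$. 1. Try to pack the items of $F$ one after the other, from the front, until one of them fits. When an item $i$ of $F$ does not fit, replace $M$ by $\{k\in M: s(k)<s(i)\}$. When an item $i$ of $F$ fits, put $S=\{i\}$, let $G=G(M,i)$ for the current $M$, remove $i$ from $M$, and go to step 2. If no item of $F$ fits, go to step 3. 2. Try to pack the items of $G$ in their order, adding those that fit to $S$; remove all of them from $M$. 3. While $M\ne\emptyset$, let $i\in M$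 have the largest density with respect to $S$ and try to pack it. If it fits, add it to $S$ and remove it from $M$; otherwise replace $M$ by $\{k\in M:s(k)<s(i)\}$. **Theorem.** For every $c\in[0,1]$ the equation $$\tfrac1c\bigl(1-e^{-cz}\bigr)=\frac{1-z}{2-(2-c)z}$$ (where for $c=0$ the left-hand side is read as its limit $z$, and $z=1$ is excluded because the right-hand side is undefined there) has a unique root $x=x(c)$ in $[0,1]$. Put $\alpha(c)=\frac{1-x(c)}{2-(2-c)x(c)}$. For every instance as above, the curvature $c$ lies in $[0,1]$, the procedure above is a policy $\Pi$ (it does not know the capacity, and it never tries an item twice), and $$f(\Pi(\gamma))\ \ge\ \alpha(c)\,f(\mathrm{Opt}(\gamma))\qquad\text{for every capacity }\gamma>0,$$ so that the robustness factor of $\Pi$ is at least $\alpha(c)$. Moreover $0.35<\alpha(1)<0.36$, and $\alpha(c)\to\tfrac12$ as $c\to0^+$. -/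

import Mathlib

open Set Filter Topology

noncomputable section

namespace Knapsack

/-- The data of an instance with unknown capacity: positive item sizes and a normalized,
monotone, submodular set function with positive values on singletons.
(Nonnegativity of `f` follows from `normalized` and `mono`.) -/
structure IsInstance {ι : Type*} [DecidableEq ι] (s : ι → ℝ) (f : Finset ι → ℝ) : Prop where
  size_pos : ∀ i, 0 < s i
  normalized : f ∅ = 0
  mono : ∀ A B : Finset ι, A ⊆ B → f A ≤ f B
  submodular : ∀ A B : Finset ι, f (A ∪ B) + f (A ∩ B) ≤ f A + f B
  singleton_pos : ∀ i, 0 < f {i}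

/-- The total size of a set of items. -/
def totalSize {ι : Type*} (s : ι → ℝ) (A : Finset ι) : ℝ := ∑ i ∈ A, s i

/-- The curvature `1 - min_j (f(N) - f(N \ {j})) / f({j})`. -/
def curvature {ι : Type*} [Fintype ι] [DecidableEq ι] [Nonempty ι] (f : Finset ι → ℝ) : ℝ :=
  1 - Finset.univ.inf' Finset.univ_nonempty
    fun j : ι => (f Finset.univ - f (Finset.univ.erase j)) / f {j}

/-- The optimal value `f(Opt(γ))`: the largest value of a set of total size at most `γ`
(used for `γ > 0`, where the empty set is feasible, so this is a maximum over a finite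
nonempty family). -/
def optValue {ι : Type*} (s : ι → ℝ) (f : Finset ι → ℝ) (γ : ℝ) : ℝ :=
  sSup (f '' {A : Finset ι | totalSize s A ≤ γ})

/-! ### Policies -/

/-- A policy is a binary decision tree. At `node i l r` it is attempted to pack item `i`; if it
fits, the process continues with `l`, and otherwise with `r`. -/
inductive Policy (ι : Type*) where
  | leaf : Policy ι
  | node (i : ι) (fits : Policy ι) (fails : Policy ι) : Policy ι

/-- No item of `used` occurs in the tree, and no item occurs twice on a path starting at the
root. -/
def Policy.NoRepeatFrom {ι : Type*} [DecidableEq ι] : Policy ι → Finset ι → Prop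
  | .leaf, _ => True
  | .node i l r, used =>
      i ∉ used ∧ l.NoRepeatFrom (insert i used) ∧ r.NoRepeatFrom (insert i used)

/-- No item occurs more than once on a path from the root to a leaf. -/
def Policy.NoRepeat {ι : Type*} [DecidableEq ι] (P : Policy ι) : Prop := P.NoRepeatFrom ∅

/-- The set `Π(γ)` of items packed by the policy when the (remaining) capacity is `γ`. -/
def Policy.packed {ι : Type*} [DecidableEq ι] (s : ι → ℝ) : Policy ι → ℝ → Finset ι
  | .leaf, _ => ∅
  | .node i l r, γ => if s i ≤ γ then insert i (l.packed s (γ - s i)) else r.packed s γ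

/-- The robustness factor `inf_γ f(Π(γ)) / f(Opt(γ))`, where `γ` ranges over the positive
capacities for which the quotient is defined, i.e. `f(Opt(γ)) > 0`. -/
def robustnessFactor {ι : Type*} [DecidableEq ι] (s : ι → ℝ) (f : Finset ι → ℝ)
    (P : Policy ι) : ℝ :=
  ⨅ γ : {γ : ℝ // 0 < γ ∧ 0 < optValue s f γ}, f (P.packed s γ.1) / optValue s f γ.1

/-! ### The algorithm

All ties are broken by the linear order on the items. -/

section Algorithm

variable {ι : Type*} [LinearOrder ι] (s : ι → ℝ) (f : Finset ι → ℝ)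

/-- The density of item `i` with respect to the set `S`. -/
def density (S : Finset ι) (i : ι) : ℝ := (f (insert i S) - f S) / s i

/-- The items of `U` with the largest density with respect to `S`. -/
def densest (S U : Finset ι) : Finset ι :=
  U.filter fun i => ∀ k ∈ U, density s f S k ≤ density s f S i

/-- The item of `U` of largest density with respect to `S`, ties being broken by the linear
order; `none` if `U` is empty. -/
def greedyChoice (S U : Finset ι) : Option ι :=
  if h : (densest s f S U).Nonempty then some ((densest s f S U).min' h) else none

theorem mem_of_greedyChoice {S U : Finset ι} {i : ι} (h : greedyChoice s f S U = some i) :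
    i ∈ U := by
  unfold greedyChoice at h
  split_ifs at h with hne
  have hi : (densest s f S U).min' hne = i := Option.some.inj h
  have hm := Finset.min'_mem _ hne
  rw [hi] at hm
  exact (Finset.mem_filter.mp hm).1

/-- The main loop of the test whether `i₀` is indispensable. `G` is the list of the items chosen
so far, in the order in which they were chosen, and `U` is the set of the remaining items. The
result is `some G` if `i₀` is indispensable, where `G` lists the items that precede `i₀` in the
greedy order, and `none` otherwise. -/
def indispensableLoop (i₀ : ι) (G : List ι) (U : Finset ι) : Option (List ι) :=
  if totalSize s G.toFinset ≤ s i₀ then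
    match h : greedyChoice s f G.toFinset U with
    | none => none
    | some i =>
      if i = i₀ then
        if G ≠ [] ∧ f G.toFinset < f (insert i G.toFinset) - f G.toFinset then some G else none
      else indispensableLoop i₀ (G ++ [i]) (U.erase i)
  else none
termination_by U.card
decreasing_by exact Finset.card_erase_lt_of_mem (mem_of_greedyChoice s f h)

/-- The test whether `i₀` is indispensable, performed with the item set `N`. -/
def isIndispensable (N : Finset ι) (i₀ : ι) : Option (List ι) :=
  indispensableLoop s f i₀ [] (N.filter fun i => s i ≤ s i₀)

/-- The items of `N` sorted non-decreasingly by size. -/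
def sortedBySize (N : Finset ι) : List ι :=
  (N.sort (· ≤ ·)).insertionSort fun i j => s i ≤ s j

/-- One iteration of the construction of the list of start items: item `i` is put in front of the
list `F` if it is indispensable, or if it is the first item in the greedy order for capacity
`s i` and `F` is not empty. -/
def startStep (N : Finset ι) (F : List ι) (i : ι) : List ι :=
  if (isIndispensable s f N i).isSome then i :: F
  else if greedyChoice s f ∅ (N.filter fun k => s k ≤ s i) = some i ∧ F ≠ [] then i :: F
  else F

/-- The list of start items. -/
def startItemList (N : Finset ι) : List ι :=
  (sortedBySize s N).foldl (startStep s f N) []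

/-- The third step: with the items `S` already packed, try to pack the items of `N` greedily. -/
def greedyPolicy (S N : Finset ι) : Policy ι :=
  match h : greedyChoice s f S N with
  | none => .leaf
  | some i =>
    .node i (greedyPolicy (insert i S) (N.erase i))
      (greedyPolicy S (N.filter fun k => s k < s i))
termination_by N.card
decreasing_by
  · exact Finset.card_erase_lt_of_mem (mem_of_greedyChoice s f h)
  · exact Finset.card_lt_card
      (Finset.filter_ssubset.mpr ⟨i, mem_of_greedyChoice s f h, lt_irrefl _⟩)

/-- The second step: with the items `S` already packed, try to pack the items of the list, one
after the other; then continue with the third step. -/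
def prefixPolicy : List ι → Finset ι → Finset ι → Policy ι
  | [], S, N => greedyPolicy s f S N
  | i :: G, S, N =>
    .node i (prefixPolicy G (insert i S) (N.erase i)) (prefixPolicy G S (N.erase i))

/-- The first step: try to pack the items of the list of start items until one of them fits. -/
def startPolicy : List ι → Finset ι → Policy ι
  | [], N => greedyPolicy s f ∅ N
  | i :: F, N =>
    .node i (prefixPolicy s f ((isIndispensable s f N i).getD []) {i} (N.erase i))
      (startPolicy F (N.filter fun k => s k < s i))

/-- The policy generated by the algorithm. Neither its construction nor its decisions use the
capacity. -/
def robustPolicy [Fintype ι] : Policy ι :=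
  startPolicy s f (startItemList s f Finset.univ) Finset.univ

end Algorithm

/-! ### The constants -/

/-- The function `(1 - e^{-cz}) / c`, read as its limit `z` for `c = 0`. -/
def growth (c z : ℝ) : ℝ := if c = 0 then z else 1 / c * (1 - Real.exp (-(c * z)))

/-- The function `(1 - z) / (2 - (2 - c) z)`. -/
def ratio (c z : ℝ) : ℝ := (1 - z) / (2 - (2 - c) * z)

/-- `x` is a root in `[0,1]` of the equation `(1 - e^{-cz}) / c = (1 - z) / (2 - (2 - c) z)`. -/
def IsRoot (c x : ℝ) : Prop := x ∈ Icc (0 : ℝ) 1 ∧ growth c x = ratio c x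

end Knapsack

end

/-!
Write `c` for the curvature, `x` for the root of the equation, and `α = (1 - x) / (2 - (2 - c) x)`,
which also equals `(1 - e^{-cx}) / c`. Fix a capacity `γ`, let `U` be the set of the items of size
at most `γ`, and let `A` be a feasible set. The proof compares `A` with a greedy sequence `L` in `U`
of total size `z γ ≤ γ`, in two ways.

* `f(L) ≥ (1 - e^{-cz}) / c · f(A)` (`IsGreedy.growth_mul_le`). The induction in
  `IsGreedy.add_growth_le` tracks `f(A ∪ P) - f(P)` for the packed prefix `P` together with the
  capacity left over by `A ∩ P`; an item outside `A` uses the curvature, an item of `A` the concavity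
  of the exponential bound.
* If `j` is the next item of the greedy order and `δ` its density, then
  `f(A) ≤ f(L) + δ (γ - (1 - c) z γ)` (`IsGreedy.le_add_density`). If `j` does not fit after `L`, its
  size exceeds `(1 - z) γ`. Hence a value `v` that is at least `f(L)` and at least the increment due to
  `j` satisfies `f(A) ≤ (2 + c z / (1 - z)) v`.

The first bound gives the factor `α` if `z ≥ x`, and the second one if `z < x`; the equation for `x`
says that they meet there (`IsGreedy.ratio_mul_le`).

It remains to see that the policy provides `v = f(Π(γ))`. If it packs a greedy sequence `L` in `U`
until an item `j` of `U` does not fit, and `z < x`, then `j` takes more than half of the capacity,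
as `x ≤ 1/2`. So `j` is larger than the start item packed, if any, and not indispensable; as the test for
`j` meets exactly the sequence `L`, the increment of `j` is at most `f(L)`
(`IsGreedy.marginal_le_of_not_indispensable`), and `v = f(L)` will do. If an indispensable start item
`i` with prefix `G` is packed, then `G` followed by `i` is the beginning of the greedy order in `U`
(`isGreedy_concat_of_isIndispensable`). If all these items fit, the policy continues this greedy
sequence. Otherwise `f({i})` bounds both the increment of `i` and `f(G)`, and `v = f({i})` will do. If the
start item is not indispensable, it is itself the first item of the greedy order, because no larger
start item fits.
-/

namespace Knapsack

/-! ### The function `growth` and the constant `α` -/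

theorem mul_growth (c z : ℝ) : c * growth c z = 1 - Real.exp (-(c * z)) := by
  unfold growth
  split_ifs with h
  · simp [h]
  · field_simp

theorem growth_zero (c : ℝ) : growth c 0 = 0 := by simp [growth]

theorem growth_add (c y h : ℝ) :
    growth c (y + h) = growth c y + (1 - c * growth c y) * growth c h := by
  rw [mul_growth]
  unfold growth
  split_ifs with hc
  · simp [hc]
  · have : -(c * (y + h)) = -(c * y) + -(c * h) := by ring
    rw [this, Real.exp_add]
    ring

theorem growth_le_self {c : ℝ} (hc : 0 ≤ c) (z : ℝ) : growth c z ≤ z := by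
  rcases hc.eq_or_lt with rfl | hc
  · simp [growth]
  · refine le_of_mul_le_mul_left ?_ hc
    rw [mul_growth]
    linarith [Real.add_one_le_exp (-(c * z))]

theorem div_one_add_le_growth {c z : ℝ} (hc : 0 ≤ c) (hz : 0 ≤ z) :
    z / (1 + c * z) ≤ growth c z := by
  rcases hc.eq_or_lt with rfl | hc
  · simp [growth]
  · have hcz : 0 < 1 + c * z := by positivity
    refine le_of_mul_le_mul_left ?_ hc
    have h1 : Real.exp (-(c * z)) ≤ (1 + c * z)⁻¹ := by
      rw [Real.exp_neg]
      exact inv_anti₀ hcz (by linarith [Real.add_one_le_exp (c * z)])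
    have h2 : c * (z / (1 + c * z)) = 1 - (1 + c * z)⁻¹ := by
      field_simp
      ring
    rw [mul_growth, h2]
    linarith

theorem growth_strictMono {c : ℝ} (hc : 0 ≤ c) : StrictMono (growth c) := by
  intro y z hyz
  rcases hc.eq_or_lt with rfl | hc
  · simpa [growth] using hyz
  · refine lt_of_mul_lt_mul_left ?_ hc.le
    rw [mul_growth, mul_growth]
    have : Real.exp (-(c * z)) < Real.exp (-(c * y)) :=
      Real.exp_lt_exp.mpr (by nlinarith)
    linarith

theorem growth_nonneg {c z : ℝ} (hc : 0 ≤ c) (hz : 0 ≤ z) : 0 ≤ growth c z := by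
  simpa [growth_zero] using (growth_strictMono hc).monotone hz

theorem continuous_growth (c : ℝ) : Continuous (growth c) := by
  by_cases h : c = 0
  · have : growth c = fun z => z := by funext z; simp [growth, h]
    rw [this]
    fun_prop
  · have : growth c = fun z => 1 / c * (1 - Real.exp (-(c * z))) := by
      funext z; simp [growth, h]
    rw [this]
    fun_prop

/-- The effect on the greedy bound of an item that lies outside the optimal set. -/
theorem growth_add_le {c y h : ℝ} (hc : 0 ≤ c) :
    growth c (y + h) ≤ growth c y + (1 - c * growth c y) * h := by
  rw [growth_add]
  have h1 : 0 ≤ 1 - c * growth c y := by rw [mul_growth]; simp [Real.exp_nonneg]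
  have := mul_le_mul_of_nonneg_left (growth_le_self hc h) h1
  linarith

/-- The effect on the greedy bound of an item that belongs to the optimal set. -/
theorem growth_convex_le {c y l : ℝ} (hc0 : 0 ≤ c) (hy0 : 0 ≤ y) (hy1 : y ≤ 1)
    (hl : 0 ≤ l) : growth c (y + l * (1 - y)) ≤ growth c y + l * (1 - growth c y) := by
  have h1 := growth_add_le (y := y) (h := l * (1 - y)) hc0
  have hg := growth_le_self hc0 y
  have hg0 := growth_nonneg hc0 hy0
  have h2 : growth c y * (1 - c * (1 - y)) ≤ y := by
    have : 0 ≤ growth c y * (c * (1 - y)) := mul_nonneg hg0 (mul_nonneg hc0 (by linarith))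
    nlinarith
  have h3 : (1 - c * growth c y) * (1 - y) ≤ 1 - growth c y := by nlinarith
  have := mul_le_mul_of_nonneg_left h3 hl
  linarith

theorem ratio_denom_pos {c z : ℝ} (hc : 0 ≤ c) (hz0 : 0 ≤ z) (hz : z < 1) :
    0 < 2 - (2 - c) * z := by nlinarith [mul_nonneg hc hz0]

theorem ratio_anti {c y z : ℝ} (hc : 0 ≤ c) (hy : 0 ≤ y) (hyz : y ≤ z) (hz : z < 1) :
    ratio c z ≤ ratio c y := by
  unfold ratio
  rw [div_le_div_iff₀ (ratio_denom_pos hc (hy.trans hyz) hz)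
    (ratio_denom_pos hc hy (hyz.trans_lt hz))]
  nlinarith [mul_le_mul_of_nonneg_left hyz hc]

theorem IsRoot.lt_one {c x : ℝ} (hc : 0 ≤ c) (h : IsRoot c x) : x < 1 := by
  refine lt_of_le_of_ne h.1.2 ?_
  rintro rfl
  have h1 := growth_strictMono hc one_pos
  rw [growth_zero, h.2] at h1
  simp [ratio] at h1

theorem IsRoot.unique {c x y : ℝ} (hc : 0 ≤ c) (hx : IsRoot c x) (hy : IsRoot c y) :
    x = y := by
  wlog hxy : x ≤ y generalizing x y
  · exact (this hy hx (le_of_not_ge hxy)).symm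
  rcases hxy.eq_or_lt with h | h
  · exact h
  · have h1 := growth_strictMono hc h
    have h2 := ratio_anti hc hx.1.1 hxy (hy.lt_one hc)
    rw [hx.2, hy.2] at h1
    linarith

theorem exists_isRoot_le_half {c : ℝ} (hc : 0 ≤ c) : ∃ x, IsRoot c x ∧ x ≤ 1 / 2 := by
  have hcont : ContinuousOn (fun z => growth c z - ratio c z) (Icc 0 (1 / 2)) := by
    refine (continuous_growth c).continuousOn.sub ?_
    refine ContinuousOn.div (by fun_prop) (by fun_prop) ?_
    intro z hz
    exact (ratio_denom_pos hc hz.1 (by linarith [hz.2])).ne'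
  have h0 : growth c 0 - ratio c 0 ≤ 0 := by
    rw [growth_zero]
    norm_num [ratio]
  have h1 : 0 ≤ growth c (1 / 2) - ratio c (1 / 2) := by
    have h2 := div_one_add_le_growth (z := 1 / 2) hc (by norm_num)
    have h3 : ratio c (1 / 2) = 1 / 2 / (1 + c * (1 / 2)) := by
      unfold ratio
      congr 1 <;> ring
    rw [h3]
    linarith
  obtain ⟨x, hx, hx0⟩ := intermediate_value_Icc (by norm_num) hcont ⟨h0, h1⟩
  exact ⟨x, ⟨⟨hx.1, by linarith [hx.2]⟩, sub_eq_zero.mp hx0⟩, hx.2⟩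

theorem IsRoot.le_half {c x : ℝ} (hc : 0 ≤ c) (h : IsRoot c x) : x ≤ 1 / 2 := by
  obtain ⟨y, hy, hy2⟩ := exists_isRoot_le_half hc
  rwa [h.unique hc hy]

theorem existsUnique_isRoot {c : ℝ} (hc : 0 ≤ c) : ∃! x, IsRoot c x := by
  obtain ⟨x, hx, -⟩ := exists_isRoot_le_half hc
  exact ⟨x, hx, fun y hy => hy.unique hc hx⟩

theorem ratio_one_bounds {x : ℝ} (h : IsRoot 1 x) :
    (0.35 : ℝ) < ratio 1 x ∧ ratio 1 x < (0.36 : ℝ) := by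
  have hx1 := h.lt_one zero_le_one
  have hx0 := h.1.1
  have hd := ratio_denom_pos zero_le_one hx0 hx1
  have hg : growth 1 x = ratio 1 x := h.2
  have hm := mul_growth 1 x
  rw [one_mul, one_mul, hg] at hm
  -- `exp (6 / 13) > 20 / 13` and `exp (7 / 16) < 25 / 16`, where `6 / 13` and `7 / 16` are the
  -- points at which `ratio 1` takes the values `0.35` and `0.36`
  constructor
  · by_contra! hle
    have hx : 6 / 13 ≤ x := by
      rw [ratio, div_le_iff₀ hd] at hle
      norm_num at hle
      linarith
    have he : Real.exp (-x) < 0.65 := by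
      rw [Real.exp_neg, inv_lt_comm₀ (Real.exp_pos x) (by norm_num)]
      have := Real.quadratic_le_exp_of_nonneg hx0
      norm_num
      nlinarith
    linarith
  · by_contra! hle
    have hx : x ≤ 7 / 16 := by
      rw [ratio, le_div_iff₀ hd] at hle
      norm_num at hle
      linarith
    have he : 0.64 < Real.exp (-x) := by
      rw [Real.exp_neg, lt_inv_comm₀ (by norm_num) (Real.exp_pos x)]
      have := Real.exp_bound' hx0 hx1.le (n := 4) (by norm_num)
      simp only [Finset.sum_range_succ, Finset.sum_range_zero, Nat.factorial] at this
      refine this.trans_lt ?_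
      have h2 : x ^ 2 ≤ (7 / 16) ^ 2 := by gcongr
      have h3 : x ^ 3 ≤ (7 / 16) ^ 3 := by gcongr
      have h4 : x ^ 4 ≤ (7 / 16) ^ 4 := by gcongr
      norm_num at h2 h3 h4 ⊢
      linarith
    linarith

/-- As `x ≤ 1 / 2` for every root `x`, the factor lies between `1 / (2 + c)` and `1 / 2`. -/
theorem tendsto_ratio {x : ℝ → ℝ} (hx : ∀ c ∈ Ioc (0 : ℝ) 1, IsRoot c (x c)) :
    Tendsto (fun c : ℝ => ratio c (x c)) (𝓝[>] 0) (𝓝 (1 / 2)) := by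
  have hlim : Tendsto (fun c : ℝ => 1 / (2 + c)) (𝓝[>] 0) (𝓝 (1 / 2)) := by
    have : ContinuousAt (fun c : ℝ => 1 / (2 + c)) 0 := by
      refine ContinuousAt.div (by fun_prop) (by fun_prop) (by norm_num)
    have h := this.tendsto.mono_left (nhdsWithin_le_nhds (s := Ioi (0 : ℝ)))
    simpa using h
  have hmem : ∀ᶠ c : ℝ in 𝓝[>] 0, c ∈ Ioc (0 : ℝ) 1 := Ioc_mem_nhdsGT one_pos
  refine tendsto_of_tendsto_of_tendsto_of_le_of_le' hlim tendsto_const_nhds ?_ ?_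
  · filter_upwards [hmem] with c hc
    have h := hx c hc
    have h2 := h.le_half hc.1.le
    have h3 := ratio_anti hc.1.le h.1.1 h2 (by norm_num)
    refine le_trans (le_of_eq ?_) h3
    have := hc.1
    unfold ratio
    rw [div_eq_div_iff (by positivity) (by linarith)]
    ring
  · filter_upwards [hmem] with c hc
    have h := hx c hc
    have h3 := ratio_anti hc.1.le le_rfl h.1.1 (h.lt_one hc.1.le)
    refine h3.trans (le_of_eq ?_)
    norm_num [ratio]

/-! ### Submodular functions and curvature -/

section Submodular

variable {ι : Type*} {s : ι → ℝ} {f : Finset ι → ℝ}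

theorem totalSize_mono (hs : ∀ i, 0 < s i) {A B : Finset ι} (h : A ⊆ B) :
    totalSize s A ≤ totalSize s B :=
  Finset.sum_le_sum_of_subset_of_nonneg h fun i _ _ => (hs i).le

theorem totalSize_nonneg (hs : ∀ i, 0 < s i) (A : Finset ι) : 0 ≤ totalSize s A :=
  Finset.sum_nonneg fun i _ => (hs i).le

theorem size_le_totalSize (hs : ∀ i, 0 < s i) {A : Finset ι} {i : ι} (h : i ∈ A) :
    s i ≤ totalSize s A :=
  Finset.single_le_sum (f := s) (fun i _ => (hs i).le) h

variable [LinearOrder ι]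

theorem totalSize_insert {A : Finset ι} {i : ι} (h : i ∉ A) :
    totalSize s (insert i A) = s i + totalSize s A := Finset.sum_insert h

theorem IsInstance.nonneg (h : IsInstance s f) (A : Finset ι) : 0 ≤ f A :=
  h.normalized ▸ h.mono ∅ A (Finset.empty_subset A)

theorem IsInstance.marginal_anti (h : IsInstance s f) {A B : Finset ι} (hAB : A ⊆ B) (i : ι) :
    f (insert i B) - f B ≤ f (insert i A) - f A := by
  have h1 := h.submodular (insert i A) B
  have h2 : insert i A ∪ B = insert i B := by
    rw [Finset.insert_union, Finset.union_eq_right.mpr hAB]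
  have h3 := h.mono A (insert i A ∩ B) (Finset.subset_inter (Finset.subset_insert i A) hAB)
  rw [h2] at h1
  linarith

theorem IsInstance.marginal_le_singleton (h : IsInstance s f) (A : Finset ι) (i : ι) :
    f (insert i A) - f A ≤ f {i} := by
  have := h.marginal_anti (Finset.empty_subset A) i
  rwa [h.normalized, sub_zero, insert_empty_eq] at this

theorem IsInstance.density_anti (h : IsInstance s f) {A B : Finset ι} (hAB : A ⊆ B) (i : ι) :
    density s f B i ≤ density s f A i :=
  div_le_div_of_nonneg_right (h.marginal_anti hAB i) (h.size_pos i).le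

theorem IsInstance.density_nonneg (h : IsInstance s f) (A : Finset ι) (i : ι) :
    0 ≤ density s f A i :=
  div_nonneg (sub_nonneg.mpr (h.mono _ _ (Finset.subset_insert i A))) (h.size_pos i).le

theorem IsInstance.density_mul_size (h : IsInstance s f) (A : Finset ι) (i : ι) :
    density s f A i * s i = f (insert i A) - f A :=
  div_mul_cancel₀ _ (h.size_pos i).ne'

theorem IsInstance.union_sub_le (h : IsInstance s f) {G D : Finset ι} {δ : ℝ}
    (hD : ∀ a ∈ D, density s f G a ≤ δ) : f (D ∪ G) - f G ≤ δ * totalSize s D := by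
  induction D using Finset.induction_on with
  | empty => simp [totalSize]
  | insert a D ha ih =>
    have h1 := ih fun b hb => hD b (Finset.mem_insert_of_mem hb)
    have h2 := h.marginal_anti (Finset.subset_union_right (s₁ := D) (s₂ := G)) a
    have h3 := mul_le_mul_of_nonneg_right (hD a (Finset.mem_insert_self a D)) (h.size_pos a).le
    rw [h.density_mul_size] at h3
    rw [Finset.insert_union, totalSize_insert ha]
    linarith

variable [Fintype ι] [Nonempty ι]

theorem IsInstance.curvature_mem (h : IsInstance s f) : curvature f ∈ Icc (0 : ℝ) 1 := by
  unfold curvature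
  constructor
  · obtain ⟨i⟩ := ‹Nonempty ι›
    have h1 := Finset.inf'_le (fun j : ι => (f Finset.univ - f (Finset.univ.erase j)) / f {j})
      (Finset.mem_univ i)
    have h2 := h.marginal_le_singleton (Finset.univ.erase i) i
    rw [Finset.insert_erase (Finset.mem_univ i)] at h2
    have h3 := (div_le_one (h.singleton_pos i)).mpr h2
    linarith
  · have h1 : 0 ≤ Finset.univ.inf' Finset.univ_nonempty
        fun j : ι => (f Finset.univ - f (Finset.univ.erase j)) / f {j} :=
      Finset.le_inf' _ _ fun j _ =>
        div_nonneg (sub_nonneg.mpr (h.mono _ _ (Finset.erase_subset _ _))) (h.singleton_pos j).le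
    linarith

theorem IsInstance.curvature_le_marginal (h : IsInstance s f) {B : Finset ι} {i : ι}
    (hi : i ∉ B) : (1 - curvature f) * f {i} ≤ f (insert i B) - f B := by
  have h1 := Finset.inf'_le (fun j : ι => (f Finset.univ - f (Finset.univ.erase j)) / f {j})
    (Finset.mem_univ i)
  have h2 := h.marginal_anti (A := B) (B := Finset.univ.erase i)
    (fun k hk => Finset.mem_erase.mpr ⟨fun e => hi (e ▸ hk), Finset.mem_univ k⟩) i
  rw [Finset.insert_erase (Finset.mem_univ i)] at h2
  have h3 : 1 - curvature f ≤ (f Finset.univ - f (Finset.univ.erase i)) / f {i} := by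
    unfold curvature
    linarith
  rw [le_div_iff₀ (h.singleton_pos i)] at h3
  linarith

theorem IsInstance.add_le_union (h : IsInstance s f) {A D : Finset ι} {δ : ℝ}
    (hAD : Disjoint A D) (hD : ∀ g ∈ D, δ * s g ≤ f {g}) :
    f A + (1 - curvature f) * (δ * totalSize s D) ≤ f (A ∪ D) := by
  induction D using Finset.induction_on with
  | empty => simp [totalSize]
  | insert a D ha ih =>
    rw [Finset.disjoint_insert_right] at hAD
    have h1 := ih hAD.2 fun b hb => hD b (Finset.mem_insert_of_mem hb)
    have h2 : a ∉ A ∪ D := by simp [hAD.1, ha]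
    have h3 := h.curvature_le_marginal h2
    have h4 := mul_le_mul_of_nonneg_left (hD a (Finset.mem_insert_self a D))
      (sub_nonneg.mpr h.curvature_mem.2)
    rw [Finset.union_insert, totalSize_insert ha]
    linarith

end Submodular

/-! ### Greedy sequences -/

section Greedy

variable {ι : Type*} [LinearOrder ι] {s : ι → ℝ} {f : Finset ι → ℝ}

theorem density_le_of_greedyChoice {S U : Finset ι} {i k : ι}
    (h : greedyChoice s f S U = some i) (hk : k ∈ U) : density s f S k ≤ density s f S i := by
  unfold greedyChoice at h
  split_ifs at h with hne
  have hm := Finset.min'_mem _ hne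
  rw [Option.some.inj h] at hm
  exact (Finset.mem_filter.mp hm).2 k hk

theorem eq_empty_of_greedyChoice {S U : Finset ι} (h : greedyChoice s f S U = none) : U = ∅ := by
  unfold greedyChoice at h
  split_ifs at h with hne
  by_contra hU
  obtain ⟨i, hi, hmax⟩ := U.exists_max_image (density s f S) (Finset.nonempty_iff_ne_empty.mpr hU)
  exact hne ⟨i, Finset.mem_filter.mpr ⟨hi, hmax⟩⟩

theorem exists_greedyChoice (s : ι → ℝ) (f : Finset ι → ℝ) (S : Finset ι) {U : Finset ι}
    (h : U.Nonempty) : ∃ i, greedyChoice s f S U = some i :=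
  Option.ne_none_iff_exists'.mp fun hn => h.ne_empty (eq_empty_of_greedyChoice hn)

/-- The greedy choice is unaffected by the removal of other items. Ties cause no trouble because
the tie-breaking order is fixed. -/
theorem greedyChoice_of_subset {S U V : Finset ι} {i : ι} (h : greedyChoice s f S U = some i)
    (hVU : V ⊆ U) (hi : i ∈ V) : greedyChoice s f S V = some i := by
  have hiU : i ∈ densest s f S U :=
    Finset.mem_filter.mpr ⟨hVU hi, fun k hk => density_le_of_greedyChoice h hk⟩
  have hiV : i ∈ densest s f S V :=
    Finset.mem_filter.mpr ⟨hi, fun k hk => density_le_of_greedyChoice h (hVU hk)⟩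
  have hmin : ∀ k ∈ densest s f S U, i ≤ k := by
    intro k hk
    unfold greedyChoice at h
    rw [dif_pos ⟨i, hiU⟩] at h
    rw [← Option.some.inj h]
    exact Finset.min'_le _ _ hk
  unfold greedyChoice
  rw [dif_pos ⟨i, hiV⟩]
  refine congrArg some (le_antisymm (Finset.min'_le _ _ hiV) (Finset.le_min' _ _ _ ?_))
  intro k hk
  obtain ⟨hkV, hkmax⟩ := Finset.mem_filter.mp hk
  refine hmin k (Finset.mem_filter.mpr ⟨hVU hkV, fun m hm => ?_⟩)
  exact (density_le_of_greedyChoice h hm).trans (hkmax i hi)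

/-- The list `L` is a greedy sequence in `U`: each of its items is the greedy choice among the
items of `U` that do not precede it, with respect to the items that precede it. -/
def IsGreedy (s : ι → ℝ) (f : Finset ι → ℝ) (U : Finset ι) (L : List ι) : Prop :=
  ∀ P i, P ++ [i] <+: L → greedyChoice s f P.toFinset (U \ P.toFinset) = some i

theorem IsGreedy.nil (U : Finset ι) : IsGreedy s f U [] := by
  intro P i h
  simp at h

theorem IsGreedy.of_prefix {U : Finset ι} {L L' : List ι} (h : IsGreedy s f U L)
    (hL : L' <+: L) : IsGreedy s f U L' :=
  fun P i hP => h P i (hP.trans hL)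

theorem IsGreedy.concat {U : Finset ι} {L : List ι} {i : ι} (h : IsGreedy s f U L)
    (hi : greedyChoice s f L.toFinset (U \ L.toFinset) = some i) :
    IsGreedy s f U (L ++ [i]) := by
  intro P k hP
  rcases List.prefix_concat_iff.mp hP with h1 | h1
  · obtain ⟨rfl, h2⟩ := List.append_inj' h1 rfl
    rw [List.cons.inj h2 |>.1]
    exact hi
  · exact h P k h1

theorem toFinset_concat (L : List ι) (i : ι) : (L ++ [i]).toFinset = insert i L.toFinset := by
  ext
  simp

theorem IsGreedy.nodup_and_subset {U : Finset ι} {L : List ι} (h : IsGreedy s f U L) :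
    L.Nodup ∧ L.toFinset ⊆ U := by
  induction L using List.reverseRecOn with
  | nil => simp
  | append_singleton L i ih =>
    have h1 := ih (h.of_prefix (List.prefix_append L [i]))
    have h2 := mem_of_greedyChoice s f (h L i List.prefix_rfl)
    rw [Finset.mem_sdiff, List.mem_toFinset] at h2
    refine ⟨List.nodup_append.mpr ⟨h1.1, List.nodup_singleton i, ?_⟩, ?_⟩
    · rintro a ha b hb rfl
      exact h2.2 (List.mem_singleton.mp hb ▸ ha)
    · rw [toFinset_concat]
      exact Finset.insert_subset h2.1 h1.2

theorem IsGreedy.density_le_singleton (hI : IsInstance s f) {U : Finset ι} {L : List ι} {j g : ι}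
    (h : IsGreedy s f U L) (hj : j ∈ U \ L.toFinset) (hg : g ∈ L) :
    density s f L.toFinset j * s g ≤ f {g} := by
  obtain ⟨P, R, rfl⟩ := List.append_of_mem hg
  have h1 := h P g ⟨R, by simp⟩
  have hP : P.toFinset ⊆ (P ++ g :: R).toFinset := by
    intro a
    simp +contextual
  have h2 := density_le_of_greedyChoice h1 (Finset.sdiff_subset_sdiff le_rfl hP hj)
  have h3 := (hI.density_anti hP j).trans h2
  have h4 := mul_le_mul_of_nonneg_right h3 (hI.size_pos g).le
  rw [hI.density_mul_size] at h4
  exact h4.trans (hI.marginal_le_singleton _ _)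

variable [Fintype ι] [Nonempty ι]

/-- The bound for a greedy sequence `P ++ R` of which `P` is already packed, in terms of the value
`f (A ∪ P) - f P` that `A` can still contribute and the part of the capacity that is not taken by
`A ∩ P`. The left-hand side does not decrease when the first item of `R` is moved to `P`. -/
theorem IsGreedy.add_growth_le (hI : IsInstance s f) {U A : Finset ι} {γ : ℝ} (hAU : A ⊆ U)
    (hA : totalSize s A ≤ γ) (P R : List ι) (h : IsGreedy s f U (P ++ R))
    (hR : totalSize s (P ++ R).toFinset ≤ γ) :
    f P.toFinset + (f (A ∪ P.toFinset) - f P.toFinset) *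
      growth (curvature f) ((totalSize s (P ++ R).toFinset - totalSize s P.toFinset) /
        (γ - totalSize s (A ∩ P.toFinset))) ≤ f (P ++ R).toFinset := by
  induction R generalizing P with
  | nil => simp [growth_zero]
  | cons i R ih =>
    have hc := hI.curvature_mem.1
    have hL : P ++ i :: R = (P ++ [i]) ++ R := by simp
    have hch := h P i ⟨R, by simp⟩
    have hi := mem_of_greedyChoice s f hch
    rw [Finset.mem_sdiff] at hi
    have hsub : (P ++ [i]).toFinset ⊆ (P ++ i :: R).toFinset := by
      intro a
      simp +contextual [or_imp]
    rw [hL] at h hR hsub ⊢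
    refine le_trans ?_ (ih (P ++ [i]) h hR)
    have hTle := totalSize_mono hI.size_pos hsub
    rw [toFinset_concat] at hTle ⊢
    rw [totalSize_insert hi.2] at hTle ⊢
    -- `T` is the total size of the items that follow `i`
    set T := totalSize s ((P ++ [i]) ++ R).toFinset - (s i + totalSize s P.toFinset) with hT
    have hT0 : 0 ≤ T := by linarith
    have hT' : totalSize s ((P ++ [i]) ++ R).toFinset - totalSize s P.toFinset = T + s i := by
      rw [hT]; ring
    rw [hT']
    set S := P.toFinset
    set δ := density s f S i with hδ
    have hsi := hI.size_pos i
    have hδi : δ * s i = f (insert i S) - f S := hI.density_mul_size S i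
    have hδ0 : 0 ≤ δ := hI.density_nonneg S i
    set W := γ - totalSize s (A ∩ S) with hW
    have hAS := totalSize_mono hI.size_pos (Finset.inter_subset_right (s₁ := A) (s₂ := S))
    have hWT : T + s i ≤ W := by linarith
    have hWpos : 0 < W := by linarith
    set u := f (A ∪ S) - f S with hu
    have hu0 : 0 ≤ u := sub_nonneg.mpr (hI.mono _ _ Finset.subset_union_right)
    have huW : u ≤ δ * W := by
      have h1 : A ∪ S = (A \ S) ∪ S := by simp
      have h2 : f ((A \ S) ∪ S) - f S ≤ δ * totalSize s (A \ S) :=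
        hI.union_sub_le fun a ha =>
          density_le_of_greedyChoice hch (Finset.sdiff_subset_sdiff hAU le_rfl ha)
      have h3 : totalSize s (A ∩ S) + totalSize s (A \ S) = totalSize s A :=
        Finset.sum_inter_add_sum_sdiff A S s
      rw [← h1] at h2
      refine h2.trans (mul_le_mul_of_nonneg_left ?_ hδ0)
      linarith
    have hfi : f (insert i S) = f S + δ * s i := by linarith
    have huW' : u / W ≤ δ := (div_le_iff₀ hWpos).mpr huW
    by_cases hiA : i ∈ A
    · have h1 : A ∪ insert i S = A ∪ S := by
        rw [Finset.union_insert, Finset.insert_eq_self.mpr (Finset.mem_union_left _ hiA)]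
      have h2 : A ∩ insert i S = insert i (A ∩ S) := Finset.inter_insert_of_mem hiA
      rw [h1, h2, totalSize_insert fun hm => hi.2 (Finset.mem_inter.mp hm).2, hfi]
      have h3 : γ - (s i + totalSize s (A ∩ S)) = W - s i := by rw [hW]; ring
      have h4 : f (A ∪ S) - (f S + δ * s i) = u - δ * s i := by rw [hu]; ring
      rw [h3, h4]
      set y := T / (W - s i) with hy
      have hy0 : 0 ≤ y := div_nonneg hT0 (by linarith)
      have hy1 : y ≤ 1 := div_le_one_of_le₀ (by linarith) (by linarith)
      -- if `i` exhausts the capacity, then `T = 0`, and `y = 0` is the right value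
      have hyT : y * (W - s i) = T := by
        rcases (show 0 ≤ W - s i by linarith).eq_or_lt with h0 | h0
        · rw [← h0]
          linarith
        · exact div_mul_cancel₀ _ h0.ne'
      have h5 := growth_convex_le (l := s i / W) hc hy0 hy1 (by positivity)
      have h6 : y + s i / W * (1 - y) = (T + s i) / W := by
        rw [← hyT]
        field_simp
        ring
      rw [h6] at h5
      have h7 : growth (curvature f) y ≤ 1 := (growth_le_self hc y).trans hy1
      have h8 := mul_le_mul_of_nonneg_left h5 hu0
      have h9 := mul_le_mul_of_nonneg_right huW'
        (mul_nonneg hsi.le (sub_nonneg.mpr h7))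
      have h10 : u * (s i / W * (1 - growth (curvature f) y)) =
        u / W * (s i * (1 - growth (curvature f) y)) := by ring
      linarith
    · have h2 : A ∩ insert i S = A ∩ S := Finset.inter_insert_of_notMem hiA
      have h3 : i ∉ A ∪ S := by simp [hiA, hi.2]
      have h4 := hI.curvature_le_marginal h3
      rw [← Finset.union_insert] at h4
      rw [h2, ← hW, hfi]
      set y := T / W with hy
      have hy0 : 0 ≤ y := div_nonneg hT0 hWpos.le
      have h5 := growth_add_le (y := y) (h := s i / W) hc
      have h6 : y + s i / W = (T + s i) / W := by rw [hy]; ring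
      rw [h6] at h5
      have h7 : 0 ≤ 1 - curvature f * growth (curvature f) y := by
        rw [mul_growth]; simp [Real.exp_nonneg]
      have h8 := mul_le_mul_of_nonneg_left h5 hu0
      have h9 := mul_le_mul_of_nonneg_right huW' (mul_nonneg hsi.le h7)
      have h10 : u * ((1 - curvature f * growth (curvature f) y) * (s i / W)) =
        u / W * (s i * (1 - curvature f * growth (curvature f) y)) := by ring
      have h11 : u - curvature f * (δ * s i) ≤ f (A ∪ insert i S) - (f S + δ * s i) := by
        have h12 := mul_le_mul_of_nonneg_left (hI.marginal_le_singleton S i)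
          (sub_nonneg.mpr hI.curvature_mem.2)
        rw [← hδi] at h12
        linarith
      have h13 := mul_le_mul_of_nonneg_right h11 (growth_nonneg hc hy0)
      linarith

theorem IsGreedy.growth_mul_le (hI : IsInstance s f) {U A : Finset ι} {γ : ℝ} (hAU : A ⊆ U)
    (hA : totalSize s A ≤ γ) {L : List ι} (h : IsGreedy s f U L)
    (hL : totalSize s L.toFinset ≤ γ) :
    growth (curvature f) (totalSize s L.toFinset / γ) * f A ≤ f L.toFinset := by
  have := IsGreedy.add_growth_le hI hAU hA [] L (by simpa using h) (by simpa using hL)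
  simpa [hI.normalized, totalSize, mul_comm] using this

/-- Compared with the packed set `L`, whose next item `j` has density `δ`, the set `A` gains at most
`δ` per unit of size outside `L`, and by the curvature it forgoes at least `(1 - c) δ` per unit of
size of `L` outside `A`. -/
theorem IsGreedy.le_add_density (hI : IsInstance s f) {U A : Finset ι} {γ : ℝ} (hAU : A ⊆ U)
    (hA : totalSize s A ≤ γ) {L : List ι} {j : ι} (h : IsGreedy s f U L)
    (hj : greedyChoice s f L.toFinset (U \ L.toFinset) = some j) :
    f A ≤ f L.toFinset + density s f L.toFinset j *
      (γ - (1 - curvature f) * totalSize s L.toFinset) := by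
  set S := L.toFinset with hS
  set δ := density s f S j with hδ
  have hδ0 : 0 ≤ δ := hI.density_nonneg S j
  have h1 : f ((A \ S) ∪ S) - f S ≤ δ * totalSize s (A \ S) :=
    hI.union_sub_le fun a ha =>
      density_le_of_greedyChoice hj (Finset.sdiff_subset_sdiff hAU le_rfl ha)
  have h2 := hI.add_le_union (A := A) (D := S \ A) (δ := δ) Finset.disjoint_sdiff fun g hg =>
    h.density_le_singleton hI (mem_of_greedyChoice s f hj)
      (List.mem_toFinset.mp (Finset.mem_sdiff.mp hg).1)
  rw [Finset.sdiff_union_self_eq_union] at h1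
  rw [Finset.union_sdiff_self_eq_union] at h2
  have h3 : totalSize s (A ∩ S) + totalSize s (A \ S) = totalSize s A :=
    Finset.sum_inter_add_sum_sdiff A S s
  have h4 : totalSize s (S ∩ A) + totalSize s (S \ A) = totalSize s S :=
    Finset.sum_inter_add_sum_sdiff S A s
  rw [Finset.inter_comm] at h4
  have h5 : totalSize s (A \ S) - (1 - curvature f) * totalSize s (S \ A) ≤
      γ - (1 - curvature f) * totalSize s S := by
    have := mul_nonneg hI.curvature_mem.1 (totalSize_nonneg hI.size_pos (A ∩ S))
    rw [← h4]
    linarith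
  have h6 := mul_le_mul_of_nonneg_left h5 hδ0
  linarith

/-- The approximation guarantee: if the greedy sequence `L` fills the fraction `x` of the
capacity, its value is large enough; otherwise its next item `j` is large, and `v` is large enough
when it is at least the value of `L` and the increment due to `j`. -/
theorem IsGreedy.ratio_mul_le (hI : IsInstance s f) {U A : Finset ι} {γ v x : ℝ} (hγ : 0 < γ)
    (hx : IsRoot (curvature f) x) (hAU : A ⊆ U) (hA : totalSize s A ≤ γ) {L : List ι} {j : ι}
    (h : IsGreedy s f U L) (hL : totalSize s L.toFinset ≤ γ)
    (hj : greedyChoice s f L.toFinset (U \ L.toFinset) = some j)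
    (hfit : γ < totalSize s L.toFinset + s j) (hv : f L.toFinset ≤ v)
    (hvj : totalSize s L.toFinset < x * γ → f (insert j L.toFinset) - f L.toFinset ≤ v) :
    ratio (curvature f) x * f A ≤ v := by
  have hc := hI.curvature_mem.1
  have hA0 := hI.nonneg A
  rcases le_or_gt (x * γ) (totalSize s L.toFinset) with hz | hz
  · rw [← hx.2]
    refine le_trans ?_ ((h.growth_mul_le hI hAU hA hL).trans hv)
    exact mul_le_mul_of_nonneg_right
      ((growth_strictMono hc).monotone ((le_div_iff₀ hγ).mpr hz)) hA0
  · replace hvj := hvj hz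
    have h1 := h.le_add_density hI hAU hA hj
    rw [← hI.density_mul_size] at hvj
    set δ := density s f L.toFinset j
    have hδ : 0 ≤ δ := hI.density_nonneg _ _
    have hx1 := hx.lt_one hc
    have hd := ratio_denom_pos hc hx.1.1 hx1
    set w := totalSize s L.toFinset
    set c := curvature f
    -- `δ (γ - w) ≤ δ s(j) ≤ v` and `w (1 - x) ≤ x (γ - w)`
    have h2 : δ * (γ - w) ≤ v :=
      (mul_le_mul_of_nonneg_left (by linarith) hδ).trans hvj
    have h3 : c * (δ * (w * (1 - x))) ≤ c * (x * v) := by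
      refine mul_le_mul_of_nonneg_left ?_ hc
      have h4 := mul_le_mul_of_nonneg_left (show w * (1 - x) ≤ x * (γ - w) by linarith) hδ
      have h5 := mul_le_mul_of_nonneg_left h2 hx.1.1
      linarith
    unfold ratio
    rw [div_mul_eq_mul_div, div_le_iff₀ hd]
    have h6 := mul_le_mul_of_nonneg_left (show f A ≤ v + (v + c * (δ * w)) by linarith)
      (sub_nonneg.mpr hx1.le)
    linarith

end Greedy

/-! ### Indispensable items -/

section Indispensable

variable {ι : Type*} [LinearOrder ι] {s : ι → ℝ} {f : Finset ι → ℝ}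

theorem IsGreedy.of_subset {U V : Finset ι} {L : List ι} (h : IsGreedy s f U L)
    (hVU : V ⊆ U) (hL : L.toFinset ⊆ V) : IsGreedy s f V L := by
  intro P i hP
  have h1 := h P i hP
  refine greedyChoice_of_subset h1 (Finset.sdiff_subset_sdiff hVU le_rfl) ?_
  have h2 := (Finset.mem_sdiff.mp (mem_of_greedyChoice s f h1)).2
  exact Finset.mem_sdiff.mpr ⟨hL (List.mem_toFinset.mpr (hP.subset (by simp))), h2⟩

theorem sdiff_erase_toFinset (V : Finset ι) (P : List ι) (i : ι) :
    (V \ P.toFinset).erase i = V \ (P ++ [i]).toFinset := by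
  rw [toFinset_concat, Finset.sdiff_insert]

theorem indispensableLoop_eq_some_of_isGreedy (hI : IsInstance s f) {V : Finset ι} {j : ι}
    (P R : List ι) (h : IsGreedy s f V (P ++ R))
    (hj : greedyChoice s f (P ++ R).toFinset (V \ (P ++ R).toFinset) = some j)
    (hsize : totalSize s (P ++ R).toFinset ≤ s j) (hne : P ++ R ≠ [])
    (hf : f (P ++ R).toFinset < f (insert j (P ++ R).toFinset) - f (P ++ R).toFinset) :
    indispensableLoop s f j P (V \ P.toFinset) = some (P ++ R) := by
  induction R generalizing P with
  | nil =>
    rw [List.append_nil] at *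
    rw [indispensableLoop, if_pos hsize]
    split
    · next h0 => rw [hj] at h0; cases h0
    · next i h0 =>
      rw [hj] at h0
      cases h0
      rw [if_pos rfl, if_pos ⟨hne, hf⟩]
  | cons i R ih =>
    have hch := h P i ⟨R, by simp⟩
    have hsub : P.toFinset ⊆ (P ++ i :: R).toFinset := by
      intro a
      simp +contextual
    have hij : i ≠ j := by
      rintro rfl
      have := (Finset.mem_sdiff.mp (mem_of_greedyChoice s f hj)).2
      simp at this
    rw [indispensableLoop, if_pos ((totalSize_mono hI.size_pos hsub).trans hsize)]
    split
    · next h0 => rw [hch] at h0; cases h0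
    · next k h0 =>
      rw [hch] at h0
      cases h0
      rw [if_neg hij, sdiff_erase_toFinset]
      have hL : P ++ i :: R = (P ++ [i]) ++ R := by simp
      rw [hL] at h hj hsize hne hf ⊢
      exact ih (P ++ [i]) h hj hsize hne hf

theorem isGreedy_of_indispensableLoop {V : Finset ι} {j : ι} {P G : List ι}
    (h : IsGreedy s f V P) (hG : indispensableLoop s f j P (V \ P.toFinset) = some G) :
    IsGreedy s f V G ∧ greedyChoice s f G.toFinset (V \ G.toFinset) = some j ∧
      totalSize s G.toFinset ≤ s j ∧ G ≠ [] ∧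
      f G.toFinset < f (insert j G.toFinset) - f G.toFinset := by
  induction hn : (V \ P.toFinset).card using Nat.strong_induction_on generalizing P with
  | _ n ih =>
    rw [indispensableLoop] at hG
    split at hG
    · next hsize =>
      split at hG
      · cases hG
      · next i h0 =>
        split at hG
        · next hij =>
          subst hij
          split at hG
          · next hP =>
            cases hG
            exact ⟨h, h0, hsize, hP⟩
          · cases hG
        · have hcard := Finset.card_erase_lt_of_mem (mem_of_greedyChoice s f h0)
          rw [sdiff_erase_toFinset] at hG hcard
          exact ih _ (hn ▸ hcard) (h.concat h0) hG rfl
    · cases hG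

theorem isIndispensable_eq_some_iff (hI : IsInstance s f) {N : Finset ι} {j : ι} {G : List ι} :
    isIndispensable s f N j = some G ↔
      IsGreedy s f (N.filter fun i => s i ≤ s j) G ∧
      greedyChoice s f G.toFinset ((N.filter fun i => s i ≤ s j) \ G.toFinset) = some j ∧
      totalSize s G.toFinset ≤ s j ∧ G ≠ [] ∧
      f G.toFinset < f (insert j G.toFinset) - f G.toFinset := by
  have h0 : (N.filter fun i => s i ≤ s j) \ ([] : List ι).toFinset =
      N.filter fun i => s i ≤ s j := by simp
  constructor
  · intro h
    exact isGreedy_of_indispensableLoop (IsGreedy.nil _) (by rwa [h0])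
  · rintro ⟨h1, h2, h3, h4, h5⟩
    have := indispensableLoop_eq_some_of_isGreedy hI [] G h1 h2 h3 h4 h5
    rwa [h0] at this

variable [Fintype ι]

/-- An item that follows a non-empty greedy sequence of at most its size passes the test with
exactly this sequence, unless its increment is at most the value of the sequence. -/
theorem IsGreedy.marginal_le_of_not_indispensable (hI : IsInstance s f) {γ : ℝ} {L : List ι}
    {j : ι} (h : IsGreedy s f (Finset.univ.filter fun i => s i ≤ γ) L)
    (hj : greedyChoice s f L.toFinset
      ((Finset.univ.filter fun i => s i ≤ γ) \ L.toFinset) = some j)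
    (hsize : totalSize s L.toFinset ≤ s j) (hne : L ≠ [])
    (hind : isIndispensable s f Finset.univ j = none) :
    f (insert j L.toFinset) - f L.toFinset ≤ f L.toFinset := by
  by_contra! hf
  have hjm := Finset.mem_sdiff.mp (mem_of_greedyChoice s f hj)
  have hjγ : s j ≤ γ := (Finset.mem_filter.mp hjm.1).2
  have hVU : (Finset.univ.filter fun i => s i ≤ s j) ⊆ Finset.univ.filter fun i => s i ≤ γ := by
    intro k
    simp only [Finset.mem_filter, Finset.mem_univ, true_and]
    exact fun hk => hk.trans hjγ
  have hLV : L.toFinset ⊆ Finset.univ.filter fun i => s i ≤ s j := by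
    intro k hk
    simpa using (size_le_totalSize hI.size_pos hk).trans hsize
  have h1 : isIndispensable s f Finset.univ j = some L :=
    (isIndispensable_eq_some_iff hI).mpr ⟨h.of_subset hVU hLV,
      greedyChoice_of_subset hj (Finset.sdiff_subset_sdiff hVU le_rfl)
        (Finset.mem_sdiff.mpr ⟨by simp, hjm.2⟩), hsize, hne, hf⟩
  rw [hind] at h1
  cases h1

/-- If no larger item that fits is indispensable or first in the greedy order, the greedy sequence
that ends with an indispensable item `i` stays greedy when all items of size at most `γ` are
available: a larger item `k` chosen after `P` instead would have density at most `f(P) / s(k)`,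
which is less than the density of `i`. -/
theorem isGreedy_concat_of_isIndispensable (hI : IsInstance s f) {γ : ℝ} {i : ι} {G : List ι}
    (hiγ : s i ≤ γ) (hG : isIndispensable s f Finset.univ i = some G)
    (hlarge : ∀ k, s k ≤ γ → s i < s k → isIndispensable s f Finset.univ k = none ∧
      greedyChoice s f ∅ (Finset.univ.filter fun m => s m ≤ s k) ≠ some k) :
    IsGreedy s f (Finset.univ.filter fun k => s k ≤ γ) (G ++ [i]) := by
  obtain ⟨h1, h2, h3, h4, h5⟩ := (isIndispensable_eq_some_iff hI).mp hG
  set V := Finset.univ.filter fun k => s k ≤ s i with hV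
  set U := Finset.univ.filter fun k => s k ≤ γ with hU
  have hVU : V ⊆ U := by
    intro k
    simp only [hV, hU, Finset.mem_filter, Finset.mem_univ, true_and]
    exact fun hk => hk.trans hiγ
  have hGi := h1.concat h2
  have hi := mem_of_greedyChoice s f h2
  have key : ∀ L, L <+: G ++ [i] → IsGreedy s f U L := by
    intro L
    induction L using List.reverseRecOn with
    | nil => exact fun _ => IsGreedy.nil U
    | append_singleton P m ih =>
      intro hL
      have hP := ih ((List.prefix_append P [m]).trans hL)
      have hPG : P <+: G := by
        rcases List.prefix_concat_iff.mp hL with e | e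
        · exact (List.append_inj' e rfl).1 ▸ List.prefix_rfl
        · exact (List.prefix_append P [m]).trans e
      have hPG' : P.toFinset ⊆ G.toFinset := fun a ha =>
        List.mem_toFinset.mpr (hPG.subset (List.mem_toFinset.mp ha))
      have hm := hGi P m hL
      have hiP : i ∈ V \ P.toFinset := Finset.sdiff_subset_sdiff le_rfl hPG' hi
      obtain ⟨k, hk⟩ := exists_greedyChoice s f P.toFinset (U := U \ P.toFinset)
        ⟨i, Finset.sdiff_subset_sdiff hVU le_rfl hiP⟩
      have hkU := Finset.mem_sdiff.mp (mem_of_greedyChoice s f hk)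
      have hkγ : s k ≤ γ := (Finset.mem_filter.mp hkU.1).2
      rcases le_or_gt (s k) (s i) with hki | hki
      · have h6 := greedyChoice_of_subset hk (Finset.sdiff_subset_sdiff hVU le_rfl)
          (Finset.mem_sdiff.mpr ⟨by simpa [hV] using hki, hkU.2⟩)
        rw [hm] at h6
        cases h6
        exact hP.concat hk
      · exfalso
        obtain ⟨hk1, hk2⟩ := hlarge k hkγ hki
        by_cases hPe : P = []
        · subst hPe
          refine hk2 (greedyChoice_of_subset (by simpa using hk) ?_ (by simp))
          intro m
          simp only [hU, Finset.mem_filter, Finset.mem_univ, true_and]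
          exact fun hm => hm.trans hkγ
        · have hPs := totalSize_mono hI.size_pos hPG'
          have h6 := hP.marginal_le_of_not_indispensable hI hk (by linarith) hPe hk1
          have h7 := density_le_of_greedyChoice hk (Finset.sdiff_subset_sdiff hVU le_rfl hiP)
          have h8 := (hI.density_anti hPG' i).trans h7
          have h9 := mul_le_mul h8 hki.le (hI.size_pos i).le (hI.density_nonneg P.toFinset k)
          rw [hI.density_mul_size, hI.density_mul_size] at h9
          have h10 := hI.mono _ _ hPG'
          linarith
  exact key _ List.prefix_rfl

end Indispensable

/-! ### The optimal value -/

section OptValue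

variable {ι : Type*} [Fintype ι]

theorem exists_optValue_eq (s : ι → ℝ) (f : Finset ι → ℝ) {γ : ℝ} (hγ : 0 < γ) :
    ∃ A, totalSize s A ≤ γ ∧ optValue s f γ = f A := by
  have hne : (f '' {A : Finset ι | totalSize s A ≤ γ}).Nonempty :=
    ⟨f ∅, ∅, by simpa [totalSize] using hγ.le, rfl⟩
  obtain ⟨A, hA, hfA⟩ := hne.csSup_mem (Set.toFinite _)
  exact ⟨A, hA, hfA.symm⟩

variable [LinearOrder ι] [Nonempty ι] {s : ι → ℝ} {f : Finset ι → ℝ}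

theorem IsInstance.exists_optValue_pos (hI : IsInstance s f) :
    ∃ γ, 0 < γ ∧ 0 < optValue s f γ := by
  obtain ⟨i⟩ := ‹Nonempty ι›
  refine ⟨s i, hI.size_pos i, (hI.singleton_pos i).trans_le ?_⟩
  exact le_csSup (Set.toFinite _).bddAbove ⟨{i}, by simp [totalSize], rfl⟩

end OptValue

/-! ### The list of start items -/

section StartItems

variable {ι : Type*} [LinearOrder ι] {s : ι → ℝ} {f : Finset ι → ℝ} {N : Finset ι}

theorem sortedBySize_perm (N : Finset ι) : (sortedBySize s N).Perm (N.sort (· ≤ ·)) :=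
  List.perm_insertionSort _ _

theorem mem_sortedBySize {i : ι} : i ∈ sortedBySize s N ↔ i ∈ N := by
  rw [(sortedBySize_perm N).mem_iff, Finset.mem_sort]

theorem nodup_sortedBySize : (sortedBySize s N).Nodup :=
  (sortedBySize_perm N).nodup_iff.mpr (Finset.sort_nodup N _)

theorem pairwise_sortedBySize : (sortedBySize s N).Pairwise fun i j => s i ≤ s j := by
  have h1 : Std.Total fun i j : ι => s i ≤ s j := ⟨fun i j => le_total (s i) (s j)⟩
  have h2 : IsTrans ι fun i j : ι => s i ≤ s j := ⟨fun _ _ _ => le_trans⟩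
  exact List.pairwise_insertionSort _ _

theorem startStep_sublist (F : List ι) (i : ι) : (startStep s f N F i).Sublist (i :: F) := by
  unfold startStep
  split_ifs
  · exact List.Sublist.refl _
  · exact List.Sublist.refl _
  · exact List.sublist_cons_self i F

theorem suffix_startStep (F : List ι) (i : ι) : F <:+ startStep s f N F i := by
  unfold startStep
  split_ifs
  · exact List.suffix_cons i F
  · exact List.suffix_cons i F
  · exact List.suffix_rfl

theorem foldl_startStep_sublist (L F : List ι) :
    (L.foldl (startStep s f N) F).Sublist (L.reverse ++ F) := by
  induction L generalizing F with
  | nil => simp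
  | cons i L ih =>
    rw [List.foldl_cons, List.reverse_cons, List.append_assoc]
    exact (ih _).trans ((List.Sublist.refl _).append (startStep_sublist F i))

theorem suffix_foldl_startStep (L F : List ι) : F <:+ L.foldl (startStep s f N) F := by
  induction L generalizing F with
  | nil => exact List.suffix_rfl
  | cons i L ih => exact (suffix_startStep F i).trans (ih _)

theorem mem_foldl_startStep {L F : List ι} {i : ι} (h : i ∈ L.foldl (startStep s f N) F) :
    i ∈ F ∨ (isIndispensable s f N i).isSome ∨
      greedyChoice s f ∅ (N.filter fun k => s k ≤ s i) = some i := by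
  induction L generalizing F with
  | nil => exact Or.inl h
  | cons k L ih =>
    rcases ih h with h1 | h1
    · unfold startStep at h1
      split_ifs at h1 with h2 h3
      · rcases List.mem_cons.mp h1 with rfl | h1
        · exact Or.inr (Or.inl h2)
        · exact Or.inl h1
      · rcases List.mem_cons.mp h1 with rfl | h1
        · exact Or.inr (Or.inr h3.1)
        · exact Or.inl h1
      · exact Or.inl h1
    · exact Or.inr h1

theorem nodup_startItemList : (startItemList s f N).Nodup := by
  refine (foldl_startStep_sublist (sortedBySize s N) []).nodup ?_
  rw [List.append_nil, List.nodup_reverse]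
  exact nodup_sortedBySize

theorem pairwise_startItemList : (startItemList s f N).Pairwise fun i j => s j ≤ s i := by
  refine List.Pairwise.sublist (foldl_startStep_sublist (sortedBySize s N) []) ?_
  rw [List.append_nil, List.pairwise_reverse]
  exact pairwise_sortedBySize

theorem indispensable_or_greedyChoice_of_mem_startItemList {i : ι}
    (h : i ∈ startItemList s f N) : (isIndispensable s f N i).isSome ∨
      greedyChoice s f ∅ (N.filter fun k => s k ≤ s i) = some i := by
  simpa using mem_foldl_startStep h

theorem mem_startItemList_of_isIndispensable {i : ι} (hi : i ∈ N)
    (h : (isIndispensable s f N i).isSome) : i ∈ startItemList s f N := by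
  obtain ⟨L₁, L₂, hL⟩ := List.append_of_mem (mem_sortedBySize (s := s).mpr hi)
  unfold startItemList
  rw [hL, List.foldl_append, List.foldl_cons]
  refine (suffix_foldl_startStep _ _).subset ?_
  simp [startStep, h]

theorem mem_startItemList_of_greedyChoice {i d : ι} (hi : i ∈ startItemList s f N)
    (hid : s i < s d) (hdN : d ∈ N)
    (hd : greedyChoice s f ∅ (N.filter fun k => s k ≤ s d) = some d) :
    d ∈ startItemList s f N := by
  obtain ⟨L₁, L₂, hL⟩ := List.append_of_mem (mem_sortedBySize (s := s).mpr hdN)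
  have hsort := pairwise_sortedBySize (s := s) (N := N)
  unfold startItemList at hi ⊢
  rw [hL] at hsort
  rw [hL, List.foldl_append] at hi ⊢
  by_cases hF : L₁.foldl (startStep s f N) [] = []
  · exfalso
    rw [hF] at hi
    have h1 := (foldl_startStep_sublist _ _).subset hi
    rw [List.append_nil, List.mem_reverse] at h1
    rcases List.mem_cons.mp h1 with rfl | h1
    · exact hid.false
    · have := List.rel_of_pairwise_cons (List.pairwise_append.mp hsort).2.1 h1
      linarith
  · rw [List.foldl_cons]
    refine (suffix_foldl_startStep _ _).subset ?_
    unfold startStep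
    split_ifs with h1 h2
    · simp
    · simp
    · exact absurd ⟨hd, hF⟩ h2

end StartItems

/-! ### The policy tries no item twice -/

section NoRepeat

variable {ι : Type*} [LinearOrder ι] {s : ι → ℝ} {f : Finset ι → ℝ}

theorem greedyPolicy_noRepeatFrom {N used : Finset ι} (S : Finset ι) (h : Disjoint N used) :
    (greedyPolicy s f S N).NoRepeatFrom used := by
  induction N using Finset.strongInduction generalizing S used with
  | H N ih =>
    rw [greedyPolicy]
    split
    · trivial
    · next i hi =>
      have hiN := mem_of_greedyChoice s f hi
      refine ⟨Finset.disjoint_left.mp h hiN, ih _ (Finset.erase_ssubset hiN) _ ?_,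
        ih (N.filter fun k => s k < s i)
          (Finset.filter_ssubset.mpr ⟨i, hiN, lt_irrefl _⟩) _ ?_⟩
      · exact Finset.disjoint_insert_right.mpr
          ⟨Finset.notMem_erase i N, h.mono_left (Finset.erase_subset i N)⟩
      · exact Finset.disjoint_insert_right.mpr
          ⟨by simp, h.mono_left (Finset.filter_subset _ N)⟩

theorem prefixPolicy_noRepeatFrom {G : List ι} {S N used : Finset ι} (hG : G.Nodup)
    (hGu : ∀ i ∈ G, i ∉ used) (h : Disjoint N used) :
    (prefixPolicy s f G S N).NoRepeatFrom used := by
  induction G generalizing S N used with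
  | nil => exact greedyPolicy_noRepeatFrom S h
  | cons i G ih =>
    rw [List.nodup_cons] at hG
    have h1 : ∀ k ∈ G, k ∉ insert i used := by
      intro k hk hk'
      rcases Finset.mem_insert.mp hk' with rfl | hk'
      · exact hG.1 hk
      · exact hGu k (List.mem_cons_of_mem i hk) hk'
    have h2 : Disjoint (N.erase i) (insert i used) := Finset.disjoint_insert_right.mpr
      ⟨Finset.notMem_erase i N, h.mono_left (Finset.erase_subset i N)⟩
    exact ⟨hGu i List.mem_cons_self, ih hG.2 h1 h2, ih hG.2 h1 h2⟩

theorem startPolicy_noRepeatFrom (hI : IsInstance s f) {F : List ι} {N used : Finset ι}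
    (hF : F.Nodup) (hFu : ∀ i ∈ F, i ∉ used) (h : Disjoint N used) :
    (startPolicy s f F N).NoRepeatFrom used := by
  induction F generalizing N used with
  | nil => exact greedyPolicy_noRepeatFrom ∅ h
  | cons i F ih =>
    rw [List.nodup_cons] at hF
    refine ⟨hFu i List.mem_cons_self, ?_, ih hF.2 ?_ ?_⟩
    · have hN : Disjoint (N.erase i) (insert i used) := Finset.disjoint_insert_right.mpr
        ⟨Finset.notMem_erase i N, h.mono_left (Finset.erase_subset i N)⟩
      cases hG : isIndispensable s f N i with
      | none => exact prefixPolicy_noRepeatFrom List.nodup_nil (by simp) hN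
      | some G =>
        obtain ⟨h1, h2, -⟩ := (isIndispensable_eq_some_iff hI).mp hG
        have h3 := h1.nodup_and_subset
        refine prefixPolicy_noRepeatFrom h3.1 (fun k hk hk' => ?_) hN
        rw [Option.getD_some, ← List.mem_toFinset] at hk
        rcases Finset.mem_insert.mp hk' with rfl | hk'
        · exact (Finset.mem_sdiff.mp (mem_of_greedyChoice s f h2)).2 hk
        · exact Finset.disjoint_left.mp h (Finset.mem_filter.mp (h3.2 hk)).1 hk'
    · intro k hk hk'
      rcases Finset.mem_insert.mp hk' with rfl | hk'
      · exact hF.1 hk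
      · exact hFu k (List.mem_cons_of_mem i hk) hk'
    · exact Finset.disjoint_insert_right.mpr
        ⟨by simp, h.mono_left (Finset.filter_subset _ N)⟩

end NoRepeat

/-! ### The packed set and its value -/

section Packed

variable {ι : Type*} [LinearOrder ι] {s : ι → ℝ} {f : Finset ι → ℝ}

theorem prefixPolicy_packed {G : List ι} {S N : Finset ι} {γ : ℝ} (hI : IsInstance s f)
    (hG : G.Nodup) (hsize : totalSize s G.toFinset ≤ γ) :
    (prefixPolicy s f G S N).packed s γ = G.toFinset ∪
      (greedyPolicy s f (G.toFinset ∪ S) (N \ G.toFinset)).packed s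
        (γ - totalSize s G.toFinset) := by
  induction G generalizing S N γ with
  | nil => simp [prefixPolicy, totalSize]
  | cons i G ih =>
    rw [List.nodup_cons] at hG
    have hi : i ∉ G.toFinset := by simpa using hG.1
    rw [List.toFinset_cons, totalSize_insert hi] at hsize ⊢
    have h0 := totalSize_nonneg hI.size_pos G.toFinset
    rw [prefixPolicy, Policy.packed, if_pos (by linarith), ih hG.2 (by linarith)]
    have h1 : N.erase i \ G.toFinset = N \ insert i G.toFinset := by
      ext
      simp
      tauto
    have h2 : γ - s i - totalSize s G.toFinset = γ - (s i + totalSize s G.toFinset) := by ring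
    rw [h1, h2, Finset.union_insert, Finset.insert_union, Finset.insert_union]

/-- The outcome of the first step: either no start item fits, or a largest fitting start item is
packed. In both cases all items that fit are still available. -/
theorem startPolicy_packed {γ : ℝ} {F : List ι} {M : Finset ι}
    (hF : F.Pairwise fun i j => s j ≤ s i) (hM : ∀ k, s k ≤ γ → k ∈ M) :
    ∃ M' : Finset ι, (∀ k, s k ≤ γ → k ∈ M') ∧
      (((∀ k ∈ F, γ < s k) ∧
        (startPolicy s f F M).packed s γ = (greedyPolicy s f ∅ M').packed s γ) ∨
      ∃ i ∈ F, s i ≤ γ ∧ (∀ k ∈ F, s k ≤ γ → s k ≤ s i) ∧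
        (startPolicy s f F M).packed s γ =
          insert i ((prefixPolicy s f ((isIndispensable s f M' i).getD []) {i}
            (M'.erase i)).packed s (γ - s i))) := by
  induction F generalizing M with
  | nil => exact ⟨M, hM, Or.inl ⟨by simp, rfl⟩⟩
  | cons i F ih =>
    rw [List.pairwise_cons] at hF
    rw [startPolicy, Policy.packed]
    split_ifs with hfit
    · refine ⟨M, hM, Or.inr ⟨i, List.mem_cons_self, hfit, ?_, rfl⟩⟩
      intro k hk _
      rcases List.mem_cons.mp hk with rfl | hk
      · exact le_rfl
      · exact hF.1 k hk
    · push Not at hfit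
      obtain ⟨M', h1, h2⟩ := ih (M := M.filter fun k => s k < s i) hF.2
        fun k hk => Finset.mem_filter.mpr ⟨hM k hk, by linarith⟩
      refine ⟨M', h1, h2.imp ?_ ?_⟩
      · rintro ⟨h3, h4⟩
        refine ⟨fun k hk => ?_, h4⟩
        rcases List.mem_cons.mp hk with rfl | hk
        · exact hfit
        · exact h3 k hk
      · rintro ⟨m, hm, hmγ, h3, h4⟩
        refine ⟨m, List.mem_cons_of_mem i hm, hmγ, fun k hk hkγ => ?_, h4⟩
        rcases List.mem_cons.mp hk with rfl | hk
        · linarith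
        · exact h3 k hk hkγ

variable [Fintype ι]

/-- The third step of the policy continues the greedy sequence `L` for the items of size at most
`γ`, until one of these items does not fit. Larger items may be tried in between, but they are
rejected. -/
theorem exists_isGreedy_of_greedyPolicy (hI : IsInstance s f) {γ : ℝ} {L : List ι}
    {U M : Finset ι} (hU : U = Finset.univ.filter fun i => s i ≤ γ) (hL : IsGreedy s f U L)
    (hUM : U \ L.toFinset ⊆ M) (hML : Disjoint M L.toFinset)
    (hsize : totalSize s L.toFinset ≤ γ) :
    ∃ L', L <+: L' ∧ IsGreedy s f U L' ∧ totalSize s L'.toFinset ≤ γ ∧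
      L'.toFinset ⊆ L.toFinset ∪
        (greedyPolicy s f L.toFinset M).packed s (γ - totalSize s L.toFinset) ∧
      (U ⊆ L'.toFinset ∨ ∃ j, greedyChoice s f L'.toFinset (U \ L'.toFinset) = some j ∧
        γ < totalSize s L'.toFinset + s j) := by
  induction M using Finset.strongInduction generalizing L with
  | H M ih =>
    rw [greedyPolicy]
    split
    · next h0 =>
      rw [eq_empty_of_greedyChoice h0] at hUM
      exact ⟨L, List.prefix_rfl, hL, hsize, Finset.subset_union_left,
        Or.inl (Finset.sdiff_eq_empty_iff_subset.mp (Finset.subset_empty.mp hUM))⟩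
    · next i h0 =>
      have hiM := mem_of_greedyChoice s f h0
      have hiL := Finset.disjoint_left.mp hML hiM
      have hL0 := totalSize_nonneg hI.size_pos L.toFinset
      rw [Policy.packed]
      split_ifs with hfit
      · have hiU : i ∈ U \ L.toFinset := by
          rw [hU]
          simp only [Finset.mem_sdiff, Finset.mem_filter, Finset.mem_univ, true_and]
          exact ⟨by linarith, hiL⟩
        have hL' := hL.concat (greedyChoice_of_subset h0 hUM hiU)
        have hsz : totalSize s (L ++ [i]).toFinset = s i + totalSize s L.toFinset := by
          rw [toFinset_concat, totalSize_insert hiL]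
        obtain ⟨L', h1, h2, h3, h4, h5⟩ := ih (M.erase i) (Finset.erase_ssubset hiM) hL'
          (by
            rw [← sdiff_erase_toFinset]
            exact Finset.erase_subset_erase i hUM)
          (by
            rw [toFinset_concat]
            exact Finset.disjoint_insert_right.mpr
              ⟨Finset.notMem_erase i M, hML.mono_left (Finset.erase_subset i M)⟩)
          (by linarith)
        refine ⟨L', (List.prefix_append L [i]).trans h1, h2, h3, ?_, h5⟩
        have h6 : γ - (s i + totalSize s L.toFinset) = γ - totalSize s L.toFinset - s i := by ring
        rwa [hsz, h6, toFinset_concat, Finset.insert_union, ← Finset.union_insert] at h4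
      · rcases le_or_gt (s i) γ with hiγ | hiγ
        · have hiU : i ∈ U \ L.toFinset := by
            rw [hU]
            simpa using ⟨hiγ, by simpa using hiL⟩
          exact ⟨L, List.prefix_rfl, hL, hsize, Finset.subset_union_left,
            Or.inr ⟨i, greedyChoice_of_subset h0 hUM hiU, by linarith⟩⟩
        · refine ih (M.filter fun k => s k < s i)
            (Finset.filter_ssubset.mpr ⟨i, hiM, lt_irrefl _⟩) hL ?_
            (hML.mono_left (Finset.filter_subset _ M)) hsize
          intro k hk
          have hkγ : s k ≤ γ := by
            have := (Finset.mem_sdiff.mp hk).1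
            rw [hU] at this
            exact (Finset.mem_filter.mp this).2
          exact Finset.mem_filter.mpr ⟨hUM hk, by linarith⟩

variable [Nonempty ι]

/-- The approximation guarantee for a run that follows the greedy order. -/
theorem ratio_mul_le_of_greedyPolicy (hI : IsInstance s f) {γ x : ℝ} (hγ : 0 < γ)
    (hx : IsRoot (curvature f) x) {A M : Finset ι} (hA : totalSize s A ≤ γ) {L : List ι}
    (hL : IsGreedy s f (Finset.univ.filter fun i => s i ≤ γ) L)
    (hM : ∀ k, s k ≤ γ → k ∉ L.toFinset → k ∈ M) (hML : Disjoint M L.toFinset)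
    (hsize : totalSize s L.toFinset ≤ γ)
    (hnot : ∀ k, s k ≤ γ → totalSize s L.toFinset < s k →
      isIndispensable s f Finset.univ k = none) :
    ratio (curvature f) x * f A ≤ f (L.toFinset ∪
      (greedyPolicy s f L.toFinset M).packed s (γ - totalSize s L.toFinset)) := by
  have hc := hI.curvature_mem.1
  have hA0 := hI.nonneg A
  have hAU : A ⊆ Finset.univ.filter fun i => s i ≤ γ := fun a ha =>
    Finset.mem_filter.mpr ⟨Finset.mem_univ a, (size_le_totalSize hI.size_pos ha).trans hA⟩
  obtain ⟨L', h1, h2, h3, h4, h5⟩ := exists_isGreedy_of_greedyPolicy (M := M) hI rfl hL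
    (fun k hk => hM k (by simpa using (Finset.mem_sdiff.mp hk).1) (Finset.mem_sdiff.mp hk).2)
    hML hsize
  refine le_trans ?_ (hI.mono _ _ h4)
  rcases h5 with h5 | ⟨j, hj, hfit⟩
  · have h6 : ratio (curvature f) x ≤ 1 := by
      refine (ratio_anti hc le_rfl hx.1.1 (hx.lt_one hc)).trans ?_
      norm_num [ratio]
    exact (mul_le_of_le_one_left hA0 h6).trans (hI.mono _ _ (hAU.trans h5))
  · refine h2.ratio_mul_le hI hγ hx hAU hA h3 hj hfit le_rfl fun hz => ?_
    have hjγ : s j ≤ γ := by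
      simpa using (Finset.mem_sdiff.mp (mem_of_greedyChoice s f hj)).1
    -- `x ≤ 1 / 2`, so that `j` takes more than half of the capacity and `L'` less than half
    have h6 := mul_le_mul_of_nonneg_right (hx.le_half hc) hγ.le
    have h7 : totalSize s L.toFinset ≤ totalSize s L'.toFinset :=
      totalSize_mono hI.size_pos fun a ha =>
        List.mem_toFinset.mpr (h1.subset (List.mem_toFinset.mp ha))
    refine h2.marginal_le_of_not_indispensable hI hj (by linarith) ?_
      (hnot j hjγ (by linarith))
    rintro rfl
    simp only [totalSize, List.toFinset_nil, Finset.sum_empty] at hfit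
    linarith

theorem ratio_mul_le_robustPolicy (hI : IsInstance s f) {γ x : ℝ} (hγ : 0 < γ)
    (hx : IsRoot (curvature f) x) {A : Finset ι} (hA : totalSize s A ≤ γ) :
    ratio (curvature f) x * f A ≤ f ((robustPolicy s f).packed s γ) := by
  have hAU : A ⊆ Finset.univ.filter fun i => s i ≤ γ := fun a ha =>
    Finset.mem_filter.mpr ⟨Finset.mem_univ a, (size_le_totalSize hI.size_pos ha).trans hA⟩
  have hind : ∀ k, k ∉ startItemList s f Finset.univ →
      isIndispensable s f Finset.univ k = none := fun k hk => by
    by_contra hne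
    exact hk (mem_startItemList_of_isIndispensable (Finset.mem_univ k)
      (Option.isSome_iff_ne_none.mpr hne))
  unfold robustPolicy
  obtain ⟨M, hM, ⟨hF, hpack⟩ | ⟨i, hiF, hiγ, hmax, hpack⟩⟩ := startPolicy_packed (γ := γ) (f := f)
    (pairwise_startItemList (s := s) (f := f) (N := Finset.univ)) fun k _ => Finset.mem_univ k
  · rw [hpack]
    have := ratio_mul_le_of_greedyPolicy hI hγ hx hA (L := []) (M := M) (IsGreedy.nil _)
      (fun k hk _ => hM k hk) (by simp) (by simpa [totalSize] using hγ.le)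
      fun k hk _ => hind k fun hkF => (hF k hkF).not_ge hk
    simpa [totalSize] using this
  · have hlarge : ∀ k, s k ≤ γ → s i < s k → k ∉ startItemList s f Finset.univ :=
      fun k hk hik hkF => (hmax k hkF hk).not_gt hik
    have hMi : isIndispensable s f M i = isIndispensable s f Finset.univ i := by
      unfold isIndispensable
      congr 1
      ext k
      simp only [Finset.mem_filter, Finset.mem_univ, true_and, and_iff_right_iff_imp]
      exact fun hk => hM k (hk.trans hiγ)
    rw [hMi] at hpack
    rw [hpack]
    cases hG : isIndispensable s f Finset.univ i with
    | none =>
      have hi : greedyChoice s f ∅ (Finset.univ.filter fun k => s k ≤ s i) = some i := by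
        simpa [hG] using indispensable_or_greedyChoice_of_mem_startItemList hiF
      -- the first item `d` of the greedy order is not larger than `i`, as it would otherwise be
      -- a larger fitting start item
      have hd : greedyChoice s f ∅ (Finset.univ.filter fun k => s k ≤ γ) = some i := by
        obtain ⟨d, hd⟩ := exists_greedyChoice s f ∅
          (U := Finset.univ.filter fun k => s k ≤ γ) ⟨i, by simpa using hiγ⟩
        have hdγ : s d ≤ γ := by simpa using mem_of_greedyChoice s f hd
        have hsub : ∀ m, s m ≤ γ → (Finset.univ.filter fun k => s k ≤ s m) ⊆
            Finset.univ.filter fun k => s k ≤ γ := by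
          intro m hm k
          simp only [Finset.mem_filter, Finset.mem_univ, true_and]
          exact fun hk => hk.trans hm
        rcases le_or_gt (s d) (s i) with hdi | hdi
        · have h1 := greedyChoice_of_subset hd (hsub i hiγ) (by simpa using hdi)
          exact hd.trans (hi.symm.trans h1).symm
        · exact absurd (mem_startItemList_of_greedyChoice hiF hdi (Finset.mem_univ d)
            (greedyChoice_of_subset hd (hsub d hdγ) (by simp))) (hlarge d hdγ hdi)
      have hL : IsGreedy s f (Finset.univ.filter fun k => s k ≤ γ) [i] :=
        (IsGreedy.nil _).concat (L := []) (by simpa using hd)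
      have hs : totalSize s [i].toFinset = s i := by simp [totalSize]
      have := ratio_mul_le_of_greedyPolicy hI hγ hx hA (M := M.erase i) hL
        (fun k hk hki => Finset.mem_erase.mpr ⟨by simpa using hki, hM k hk⟩)
        (by simp) (hs ▸ hiγ)
        fun k hk hik => hind k (hlarge k hk (hs ▸ hik))
      have hsing : [i].toFinset = {i} := by simp
      rw [hs, hsing, ← Finset.insert_eq] at this
      exact this
    | some G =>
      obtain ⟨h1, h2, h3, h4, h5⟩ := (isIndispensable_eq_some_iff hI).mp hG
      have hGi := isGreedy_concat_of_isIndispensable hI hiγ hG fun k hk hik =>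
        ⟨hind k (hlarge k hk hik), fun hgr => hlarge k hk hik
          (mem_startItemList_of_greedyChoice hiF hik (Finset.mem_univ k) hgr)⟩
      have hiG : i ∉ G.toFinset := (Finset.mem_sdiff.mp (mem_of_greedyChoice s f h2)).2
      have hs : totalSize s (G ++ [i]).toFinset = s i + totalSize s G.toFinset := by
        rw [toFinset_concat, totalSize_insert hiG]
      rw [Option.getD_some]
      rcases le_or_gt (s i + totalSize s G.toFinset) γ with hfit | hfit
      · rw [prefixPolicy_packed hI h1.nodup_and_subset.1 (by linarith)]
        have := ratio_mul_le_of_greedyPolicy hI hγ hx hA (M := M.erase i \ G.toFinset) hGi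
          (fun k hk hki => by
            rw [toFinset_concat, Finset.mem_insert, not_or] at hki
            exact Finset.mem_sdiff.mpr ⟨Finset.mem_erase.mpr ⟨hki.1, hM k hk⟩, hki.2⟩)
          (by
            rw [toFinset_concat]
            exact Finset.disjoint_insert_right.mpr ⟨by simp, Finset.sdiff_disjoint⟩)
          (hs ▸ hfit)
          fun k hk hik => hind k (hlarge k hk (by
            linarith [totalSize_nonneg hI.size_pos G.toFinset]))
        rw [hs, toFinset_concat] at this
        have e1 : G.toFinset ∪ {i} = insert i G.toFinset := by
          rw [Finset.union_comm, Finset.insert_eq]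
        have e2 : γ - s i - totalSize s G.toFinset = γ - (s i + totalSize s G.toFinset) := by ring
        rw [e1, e2, ← Finset.insert_union]
        exact this
      · -- `i` alone is worth at least its increment, and this exceeds the value of `G`
        have h6 := hI.marginal_le_singleton G.toFinset i
        refine le_trans ?_ (hI.mono {i} _ (by simp))
        exact IsGreedy.ratio_mul_le hI hγ hx hAU hA (hGi.of_prefix (List.prefix_append G [i]))
          (h3.trans hiγ) (hGi G i List.prefix_rfl) (by linarith) (by linarith) fun _ => h6

end Packed

end Knapsack

theorem mainTheorem1 :
    -- the equation has exactly one root in `[0,1]`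
    (∀ c ∈ Icc (0 : ℝ) 1, ∃! x, Knapsack.IsRoot c x) ∧
    -- the policy achieves the factor given by this root
    (∀ (ι : Type*) [Fintype ι] [LinearOrder ι] [Nonempty ι] (s : ι → ℝ) (f : Finset ι → ℝ),
      Knapsack.IsInstance s f →
      Knapsack.curvature f ∈ Icc (0 : ℝ) 1 ∧
      (Knapsack.robustPolicy s f).NoRepeat ∧
      ∀ x, Knapsack.IsRoot (Knapsack.curvature f) x →
        (∀ γ : ℝ, 0 < γ →
          (1 - x) / (2 - (2 - Knapsack.curvature f) * x) * Knapsack.optValue s f γ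
            ≤ f ((Knapsack.robustPolicy s f).packed s γ)) ∧
        (1 - x) / (2 - (2 - Knapsack.curvature f) * x)
          ≤ Knapsack.robustnessFactor s f (Knapsack.robustPolicy s f)) ∧
    -- the value of the factor for `c = 1`
    (∀ x, Knapsack.IsRoot 1 x →
      (0.35 : ℝ) < (1 - x) / (2 - (2 - 1) * x) ∧ (1 - x) / (2 - (2 - 1) * x) < (0.36 : ℝ)) ∧
    -- the limit of the factor for `c → 0`
    (∀ x : ℝ → ℝ, (∀ c ∈ Ioc (0 : ℝ) 1, Knapsack.IsRoot c (x c)) →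
      Tendsto (fun c : ℝ => (1 - x c) / (2 - (2 - c) * x c)) (𝓝[>] 0) (𝓝 (1 / 2))) := by
  refine ⟨fun c hc => Knapsack.existsUnique_isRoot hc.1, ?_,
    fun x hx => Knapsack.ratio_one_bounds hx, fun x hx => Knapsack.tendsto_ratio hx⟩
  intro ι _ _ _ s f hI
  refine ⟨hI.curvature_mem, ?_, fun x hx => ?_⟩
  · exact Knapsack.startPolicy_noRepeatFrom hI Knapsack.nodup_startItemList (by simp) (by simp)
  · have hopt : ∀ γ : ℝ, 0 < γ →
        (1 - x) / (2 - (2 - Knapsack.curvature f) * x) * Knapsack.optValue s f γ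
          ≤ f ((Knapsack.robustPolicy s f).packed s γ) := by
      intro γ hγ
      obtain ⟨A, hA, hfA⟩ := Knapsack.exists_optValue_eq s f hγ
      rw [hfA]
      exact Knapsack.ratio_mul_le_robustPolicy hI hγ hx hA
    refine ⟨hopt, ?_⟩
    obtain ⟨γ₀, hγ₀⟩ := hI.exists_optValue_pos
    have : Nonempty {γ : ℝ // 0 < γ ∧ 0 < Knapsack.optValue s f γ} := ⟨⟨γ₀, hγ₀⟩⟩
    exact le_ciInf fun γ => (le_div_iff₀ γ.2.2).mpr (hopt γ.1 γ.2.1)
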